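/- **Setting.** For real numbers $\alpha,\beta,\gamma,\delta$ put $A_0=B_0=0$ and, for $n\ge 1$, $A_n=\lfloor n\alpha+\gamma\rfloor$, $B_n=\lfloor n\beta+\delta\rfloor$. The sequences are *complementary Beatty sequences* if $0<\alpha<\beta$ are irrational, $\frac1\alpha+\frac1\beta=1$, and $\{A_n\mid n\ge1\}$, $\{B_n\mid n\ge 1\}$ partition $\mathbb N_{>0}$; they are *non-homogeneous* if $(\gamma,\delta)\neq(0,0)$. The *standing assumptions* are that moreover $A_1=1$, $B_1\ge 3$, $\frac\gamma\alpha+\frac\delta\beta=0$ and $n\beta+\delta\notin\mathbb Z$ for all $n\ge1$. Let $\mathcal P=\{(A_n,B_n)\mid n\ge0\}\cup\{(B_n,A_n)\mid n\ge0\}$. An *invariant game* (on two heaps) is given by a set $M\subseteq\mathbb N^2\setminus\{(0,0)\}$ of moves; from $(x,y)$ one may play any $(i,j)\in M$ with $i\le x$, $j\le y$, leading to $(x-i,y-j)$, and the player who makes the last move wins. A position is a *$P$-position* if the second player has a winning strategy. The pair $(A_n,B_n)$ *gives rise to an invariant game* if some invariant game has exactly $\mathcal P$ as its set of $P$-positions.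 The sequence $(B_n)_{n>0}$ is *superadditive* if $B_m+B_n\le B_{m+n}$ for all $m,n>0$, and *$B_1$-superadditive* if $B_m+B_n\le B_{m+n}<B_m+B_n+B_1$ for all $m,n>0$. **Good 4-tuples.** Let $\mathbf w=w_0w_1w_2\cdots$ with $w_n=(A_{n+1}-A_n,B_{n+1}-B_n)$, and let $a=(1,\lfloor\beta\rfloor)$, $b=(1,\lfloor\beta\rfloor+1)$, $c=(2,\lfloor\beta\rfloor)$, $d=(2,\lfloor\beta\rfloor+1)$. For a finite word $u$ let $|u|_x$ be the number of occurrences of $x$ in $u$ and $\Psi(u)=(|u|_a,|u|_b,|u|_c,|u|_d)$; let $\mathrm{Fac}_n$ be the set of factors of length $n$ of $\mathbf w$, and $\pi_2(x,y)=y$. * A prefix $w_0u$ of $\mathbf w$ with $u=w_1\cdots w_n$, $n\ge1$, is *bad* if $u\in\{a,b\}^*$, $w_1\cdots w_{n-1}$ is a palindrome, and for some $v\in\mathrm{Fac}_n$ one of the following holds: (i) $2B_1=\pi_2(w_n)-1$ and $\Psi(v)-\Psi(u)\in\{(0,-1,1,0),(1,-2,0,1)\}$; (ii) $2B_1=\pi_2(w_n)$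 and $\Psi(v)-\Psi(u)\in\{(-1,0,1,0),(0,-1,0,1)\}$; (iii) $2B_1=\pi_2(w_n)+1$ and $\Psi(v)-\Psi(u)\in\{(-1,0,0,1),(-2,1,1,0)\}$. * A factor $u=u_1\cdots u_n\in\{a,b\}^*$ of $\mathbf w$ ($n\ge1$) satisfies (B.1) if some $v\in\mathrm{Fac}_n\cap\{a,b\}^*$ has $|v|_b<|u|_b$; it satisfies (B.2) if some $v'\in\mathrm{Fac}_{n-1}$ has $\Psi(v')-\Psi(u_1\cdots u_{n-1})\in\{(0,-1,1,0),(1,-2,0,1)\}$. It is *suffix-bad* if all suffixes $u_j\cdots u_n$, $1\le j\le n$, satisfy (B.1), or if $n\ge2$ and all suffixes $u_j\cdots u_n$, $1\le j\le n-1$, satisfy (B.2). * The 4-tuple $(\alpha,\beta,\gamma,\delta)$ is *good* if either $\gamma>0$ and no prefix $w_0w_1\cdots w_k$ with $1\le k\le B_1-2$ and $w_1,\dots,w_k\in\{a,b\}$ is bad, or $\gamma<0$ and no prefix of $\mathbf w$ in $\{a,b\}^*$ of length $n$, $1\le n<B_1$, is suffix-bad. **Theorem.** $B_1$-superadditivity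 is not a necessary condition for the existence of an invariant game. More precisely: 1. Let $\beta=1.99+\frac{\sqrt5}2$, $\alpha=\frac{\beta}{\beta-1}$, $\gamma=-0.2$, $\delta=-\frac{\beta\gamma}{\alpha}$. Then the standing assumptions hold, $(\alpha,\beta,\gamma,\delta)$ is good, the pair $(A_n,B_n)$ gives rise to an invariant game, and $(B_n)_{n>0}$ is not superadditive, hence not $B_1$-superadditive. 2. Let $\beta=8+\frac{1+\sqrt5}2$, $\alpha=\frac{\beta}{\beta-1}$, $\delta=-\frac{5\sqrt7}2$, $\gamma=-\frac{\delta\alpha}{\beta}>0$. Then the standing assumptions hold, $(\alpha,\beta,\gamma,\delta)$ is good, the pair $(A_n,B_n)$ gives rise to an invariant game, and $(B_n)_{n>0}$ is superadditive; but $B_1=3$, $B_2=12$, $B_3=22$, so that $B_3>2B_1+B_2$ and $(B_n)_{n>0}$ is not $B_1$-superadditive. 3. Consequently it is not true that every pair of non-homogeneous complementary Beatty sequences with $A_1=1$ that gives rise to an invariant game has a $B_1$-superadditive sequence $(B_n)_{n>0}$. In particular the conjecture of Larsson, Hegarty and Fraenkel, that a pair of non-homogeneous complementary Beatty sequences with $A_1=1$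 gives rise to an invariant game if and only if $(B_n)_{n>0}$ is $B_1$-superadditive, is false. -/

import Mathlib

namespace BeattyGame

/-! ## Invariant games on two heaps -/

/-- An invariant game on two heaps: a set of allowed moves `(i, j)` (the numbers of tokens removed
from the two heaps), each removing at least one token. A move is playable from every position that
has enough tokens. -/
structure InvariantGame where
  moves : Set (ℕ × ℕ)
  zero_notMem : (0, 0) ∉ moves

namespace InvariantGame

/-- `q` is reached from `p` by playing one allowed move. -/
def IsOption (G : InvariantGame) (p q : ℕ × ℕ) : Prop :=
  ∃ m ∈ G.moves, p = q + m

/-- The player to move from `p` has a winning strategy (a player who cannot move loses): there is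
a move to some `q` such that, whatever the opponent replies, the player to move wins again. -/
inductive FirstWins (G : InvariantGame) : ℕ × ℕ → Prop
  | intro (p q : ℕ × ℕ) (hq : G.IsOption p q) (h : ∀ r, G.IsOption q r → FirstWins G r) :
      FirstWins G p

/-- The player who moves second from `p` has a winning strategy. -/
def IsPPosition (G : InvariantGame) (p : ℕ × ℕ) : Prop :=
  ∀ q, G.IsOption p q → G.FirstWins q

/-- The set of P-positions of the game. -/
def pPositions (G : InvariantGame) : Set (ℕ × ℕ) := {p | G.IsPPosition p}

end InvariantGame

/-! ## Non-homogeneous Beatty sequences -/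

/-- The sequence `⌊n θ + ρ⌋` for `n ≥ 1`, with value `0` at `n = 0`. -/
noncomputable def seq (θ ρ : ℝ) (n : ℕ) : ℤ := if n = 0 then 0 else ⌊(n : ℝ) * θ + ρ⌋

/-- `A = (⌊n α + γ⌋)` and `B = (⌊n β + δ⌋)`, `n ≥ 1`, are complementary Beatty sequences. -/
structure Complementary (α β γ δ : ℝ) : Prop where
  pos : 0 < α
  lt : α < β
  irrational_left : Irrational α
  irrational_right : Irrational β
  inv_add_inv : 1 / α + 1 / β = 1
  disjoint : Disjoint {k : ℤ | ∃ n : ℕ, 1 ≤ n ∧ seq α γ n = k}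
    {k : ℤ | ∃ n : ℕ, 1 ≤ n ∧ seq β δ n = k}
  union : {k : ℤ | ∃ n : ℕ, 1 ≤ n ∧ seq α γ n = k} ∪ {k : ℤ | ∃ n : ℕ, 1 ≤ n ∧ seq β δ n = k} =
    {k : ℤ | 0 < k}

/-- The standing assumptions on the 4-tuple `(α, β, γ, δ)`. -/
structure Standing (α β γ δ : ℝ) : Prop extends Complementary α β γ δ where
  first_left : seq α γ 1 = 1
  first_right : 3 ≤ seq β δ 1
  balance : γ / α + δ / β = 0
  not_int : ∀ n : ℕ, 1 ≤ n → ∀ k : ℤ, (n : ℝ) * β + δ ≠ k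

/-- The set `{(A n, B n) | n ≥ 0} ∪ {(B n, A n) | n ≥ 0}`, as a set of game positions. -/
def positions (α β γ δ : ℝ) : Set (ℕ × ℕ) :=
  {p | ∃ n : ℕ, ((p.1 : ℤ) = seq α γ n ∧ (p.2 : ℤ) = seq β δ n) ∨
    ((p.1 : ℤ) = seq β δ n ∧ (p.2 : ℤ) = seq α γ n)}

/-- Some invariant game has exactly `positions α β γ δ` as its set of P-positions. -/
def HasInvariantGame (α β γ δ : ℝ) : Prop :=
  ∃ G : InvariantGame, G.pPositions = positions α β γ δ

/-- `B m + B n ≤ B (m + n)` for all `m, n > 0`. -/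
def Superadditive (B : ℕ → ℤ) : Prop :=
  ∀ m n : ℕ, 0 < m → 0 < n → B m + B n ≤ B (m + n)

/-- `B m + B n ≤ B (m + n) < B m + B n + B 1` for all `m, n > 0`. -/
def FirstSuperadditive (B : ℕ → ℤ) : Prop :=
  ∀ m n : ℕ, 0 < m → 0 < n → B m + B n ≤ B (m + n) ∧ B (m + n) < B m + B n + B 1

/-- The conjecture of Larsson, Hegarty and Fraenkel: a pair of non-homogeneous complementary Beatty
sequences with `A 1 = 1` gives rise to an invariant game if and only if `(B n)`, `n > 0`, is
`B 1`-superadditive. -/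
def LarssonHegartyFraenkelConjecture : Prop :=
  ∀ α β γ δ : ℝ, Complementary α β γ δ → (γ ≠ 0 ∨ δ ≠ 0) → seq α γ 1 = 1 →
    (HasInvariantGame α β γ δ ↔ FirstSuperadditive (seq β δ))

/-! ## The word `w` and good 4-tuples -/

/-- Letters are pairs of integers, the first differences of the two sequences. -/
abbrev Letter := ℤ × ℤ

/-- The infinite word `w n = (A (n+1) - A n, B (n+1) - B n)`. -/
noncomputable def word (α β γ δ : ℝ) (n : ℕ) : Letter :=
  (seq α γ (n + 1) - seq α γ n, seq β δ (n + 1) - seq β δ n)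

noncomputable def letterA (β : ℝ) : Letter := (1, ⌊β⌋)
noncomputable def letterB (β : ℝ) : Letter := (1, ⌊β⌋ + 1)
noncomputable def letterC (β : ℝ) : Letter := (2, ⌊β⌋)
noncomputable def letterD (β : ℝ) : Letter := (2, ⌊β⌋ + 1)

/-- The finite word uses the letters `a` and `b` only. -/
def IsAB (β : ℝ) (u : List Letter) : Prop := ∀ x ∈ u, x = letterA β ∨ x = letterB β

/-- The Parikh vector `(|u|_a, |u|_b, |u|_c, |u|_d)`. -/
noncomputable def parikh (β : ℝ) (u : List Letter) : ℤ × ℤ × ℤ × ℤ :=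
  (u.count (letterA β), u.count (letterB β), u.count (letterC β), u.count (letterD β))

/-- The factor `w i ⋯ w (i+n-1)` of length `n` occurring in position `i`. -/
def factor (w : ℕ → Letter) (i n : ℕ) : List Letter := (List.range n).map fun j => w (i + j)

/-- The set of factors of length `n` of the infinite word `w`. -/
def factors (w : ℕ → Letter) (n : ℕ) : Set (List Letter) := {v | ∃ i : ℕ, v = factor w i n}

/-- For `n ≥ 1`, the prefix `w 0 u` of `w`, with `u = w 1 ⋯ w n = u' x` and `x = w n`, is bad. Here
`B1` is the first term of the sequence `B`. -/
def IsBad (β : ℝ) (w : ℕ → Letter) (B1 : ℤ) (n : ℕ) : Prop :=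
  IsAB β (factor w 1 n) ∧ (factor w 1 (n - 1)).Palindrome ∧
    ((2 * B1 = (w n).2 - 1 ∧ ∃ v ∈ factors w n,
        parikh β v = parikh β (factor w 1 n) + (0, -1, 1, 0) ∨
        parikh β v = parikh β (factor w 1 n) + (1, -2, 0, 1)) ∨
     (2 * B1 = (w n).2 ∧ ∃ v ∈ factors w n,
        parikh β v = parikh β (factor w 1 n) + (-1, 0, 1, 0) ∨
        parikh β v = parikh β (factor w 1 n) + (0, -1, 0, 1)) ∨
     (2 * B1 = (w n).2 + 1 ∧ ∃ v ∈ factors w n,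
        parikh β v = parikh β (factor w 1 n) + (-1, 0, 0, 1) ∨
        parikh β v = parikh β (factor w 1 n) + (-2, 1, 1, 0)))

/-- Some factor `v` over `{a, b}` with the length of `u` has fewer letters `b` than `u`. -/
def PropB1 (β : ℝ) (w : ℕ → Letter) (u : List Letter) : Prop :=
  ∃ v ∈ factors w u.length, IsAB β v ∧ v.count (letterB β) < u.count (letterB β)

/-- With `u = u' x`, some factor `v` with the length of `u'` has
`Ψ v = Ψ u' + (0,-1,1,0)` or `Ψ v = Ψ u' + (1,-2,0,1)`, where `Ψ` is the Parikh vector. -/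
def PropB2 (β : ℝ) (w : ℕ → Letter) (u : List Letter) : Prop :=
  ∃ v ∈ factors w (u.length - 1),
    parikh β v = parikh β u.dropLast + (0, -1, 1, 0) ∨
    parikh β v = parikh β u.dropLast + (1, -2, 0, 1)

/-- For a non-empty word `u`: all its non-empty suffixes satisfy `PropB1`, or `u` has length at
least two and all its suffixes of length at least two satisfy `PropB2`. -/
def IsSuffixBad (β : ℝ) (w : ℕ → Letter) (u : List Letter) : Prop :=
  (∀ j < u.length, PropB1 β w (u.drop j)) ∨
    (2 ≤ u.length ∧ ∀ j < u.length - 1, PropB2 β w (u.drop j))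

/-- Good 4-tuples. -/
def Good (α β γ δ : ℝ) : Prop :=
  (0 < γ ∧ ∀ k : ℕ, 1 ≤ k → (k : ℤ) + 1 < seq β δ 1 →
      IsAB β (factor (word α β γ δ) 1 k) → ¬ IsBad β (word α β γ δ) (seq β δ 1) k) ∨
    (γ < 0 ∧ ∀ n : ℕ, 1 ≤ n → (n : ℤ) < seq β δ 1 →
      IsAB β (factor (word α β γ δ) 0 n) →
        ¬ IsSuffixBad β (word α β γ δ) (factor (word α β γ δ) 0 n))

end BeattyGame

/-! A move joining two elements of P is forbidden, so the most generous candidate is the game whose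
moves are all the non-differences of P. It has P as its set of P-positions once every position
outside P reaches P by a non-difference (`exists_pPositions_eq`).

For B₁ = 3 such replies are explicit (`StepPair.exists_reply`). Take x ≤ y. Two positions of P never
share a nonzero coordinate, so one-heap moves are always allowed; they settle every case except x =
A n, y < B n. There the move to (0, 0) works unless (x, y) is itself a difference, necessarily (A m
- A k, B m - B k) with 1 ≤ k < m. The exceptional positions are answered by moving to (3, 1), or to
(1, 3) when x = 2. The first of these replies rests on a slope estimate for Beatty sequences
(`Standing.hasInvariantGame`), the second on the sizes of the steps of B.

None of this needs `FirstSuperadditive`. Both 4-tuples satisfy the numerical hypotheses, and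
superadditivity and goodness are read off from a few initial terms, or from the sign and size of δ.
-/

namespace BeattyGame

/-! ## The invariant game with the largest set of moves -/

/-- The differences of elements of `P`; none of them can be a move of an invariant game with set of
P-positions `P`. -/
def differences (P : Set (ℕ × ℕ)) : Set (ℕ × ℕ) := {d | ∃ q ∈ P, q + d ∈ P}

theorem InvariantGame.IsOption.sum_lt {G : InvariantGame} {p q : ℕ × ℕ} (h : G.IsOption p q) :
    q.1 + q.2 < p.1 + p.2 := by
  obtain ⟨m, hm, rfl⟩ := h
  have : m ≠ (0, 0) := fun h => G.zero_notMem (h ▸ hm)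
  rcases m with ⟨i, j⟩
  have : i ≠ 0 ∨ j ≠ 0 := by
    by_contra! h
    exact this (by rw [h.1, h.2])
  simp only [Prod.fst_add, Prod.snd_add]
  omega

theorem InvariantGame.not_isPPosition_of_firstWins {G : InvariantGame} (p : ℕ × ℕ)
    (h : G.FirstWins p) : ¬ G.IsPPosition p := by
  induction hs : p.1 + p.2 using Nat.strong_induction_on generalizing p with
  | _ s ih =>
    intro hp
    obtain ⟨_, q, hq, hr⟩ := h
    exact ih _ (hs ▸ hq.sum_lt) q (hp q hq) rfl hr

theorem exists_pPositions_eq {P : Set (ℕ × ℕ)} (h0 : (0, 0) ∈ P)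
    (h : ∀ p ∉ P, ∃ q ∈ P, ∃ d ∉ differences P, p = q + d) :
    ∃ G : InvariantGame, G.pPositions = P := by
  -- The zero move is excluded because it is the difference of (0, 0) ∈ P with itself.
  let G : InvariantGame := ⟨(differences P)ᶜ, fun h => h ⟨(0, 0), h0, h0⟩⟩
  have key : ∀ p, (p ∈ P → G.IsPPosition p) ∧ (p ∉ P → G.FirstWins p) := by
    intro p
    induction hs : p.1 + p.2 using Nat.strong_induction_on generalizing p with
    | _ s ih =>
      refine ⟨fun hp q hq => ?_, fun hp => ?_⟩
      · refine (ih _ (hs ▸ hq.sum_lt) q rfl).2 fun hqP => ?_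
        obtain ⟨m, hm, rfl⟩ := hq
        exact hm ⟨q, hqP, hp⟩
      · obtain ⟨q, hq, d, hd, rfl⟩ := h p hp
        have ho : G.IsOption (q + d) q := ⟨d, hd, rfl⟩
        exact .intro _ q ho ((ih _ (hs ▸ ho.sum_lt) q rfl).1 hq)
  refine ⟨G, Set.ext fun p => ⟨fun hp => ?_, (key p).1⟩⟩
  by_contra hP
  exact InvariantGame.not_isPPosition_of_firstWins p ((key p).2 hP) hp

/-! ## Pairs of sequences with small and large steps -/

/-- `(x, y)` is one of the pairs `(A n, B n)`, `(B n, A n)`. -/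
def IsPos (A B : ℕ → ℤ) (x y : ℤ) : Prop := ∃ n, (x = A n ∧ y = B n) ∨ (x = B n ∧ y = A n)

/-- `(x, y)` is the difference of a pair `(A m, B m)` and a pair `(A k, B k)` or `(B k, A k)`. -/
def IsDiff (A B : ℕ → ℤ) (x y : ℤ) : Prop :=
  ∃ m k, (x = A m - A k ∧ y = B m - B k) ∨ (x = A m - B k ∧ y = B m - A k)

/-- Two sequences that partition the positive integers, the first with steps `1` and `2`, the second
with steps at least `3`. -/
structure StepPair (A B : ℕ → ℤ) : Prop where
  A_zero : A 0 = 0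
  B_zero : B 0 = 0
  A_one : A 1 = 1
  B_one : B 1 = 3
  A_lt : ∀ n, A n < A (n + 1)
  A_le : ∀ n, A (n + 1) ≤ A n + 2
  B_le : ∀ n, B n + 3 ≤ B (n + 1)
  cover : ∀ k : ℤ, 0 < k → ∃ n, 1 ≤ n ∧ (A n = k ∨ B n = k)
  ne : ∀ m n, A m = B n → m = 0 ∧ n = 0

namespace StepPair

variable {A B : ℕ → ℤ}

theorem strictMono_A (h : StepPair A B) : StrictMono A := strictMono_nat_of_lt_succ h.A_lt

theorem strictMono_B (h : StepPair A B) : StrictMono B :=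
  strictMono_nat_of_lt_succ fun n => by linarith [h.B_le n]

theorem strictMono_sub (h : StepPair A B) : StrictMono fun n => B n - A n :=
  strictMono_nat_of_lt_succ fun n => by linarith [h.B_le n, h.A_le n]

theorem A_nonneg (h : StepPair A B) (n : ℕ) : 0 ≤ A n := h.A_zero ▸ h.strictMono_A.monotone n.zero_le

theorem A_le_B (h : StepPair A B) (n : ℕ) : A n ≤ B n := by
  have := h.strictMono_sub.monotone n.zero_le
  simp only [h.A_zero, h.B_zero] at this
  linarith

theorem A_lt_B (h : StepPair A B) {n : ℕ} (hn : n ≠ 0) : A n < B n := by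
  have := h.strictMono_sub (Nat.pos_of_ne_zero hn)
  simp only [h.A_zero, h.B_zero] at this
  linarith

theorem B_nonneg (h : StepPair A B) (n : ℕ) : 0 ≤ B n := (h.A_nonneg n).trans (h.A_le_B n)

/-- B - A is strictly increasing and vanishes only at 0, so a nonzero difference with x ≥ 0 lies
strictly above the diagonal. Hence for x ≤ y the swapped orientation never has to be examined. -/
theorem isDiff_lt (h : StepPair A B) {x y : ℤ} (hd : IsDiff A B x y) (hx : 0 ≤ x) :
    x < y ∨ (x = 0 ∧ y = 0) := by
  obtain ⟨m, k, ⟨rfl, rfl⟩ | ⟨rfl, rfl⟩⟩ := hd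
  · have hkm : k ≤ m := h.strictMono_A.le_iff_le.1 (by linarith)
    rcases hkm.eq_or_lt with rfl | hlt
    · exact .inr ⟨by ring, by ring⟩
    · exact .inl (by linarith [h.strictMono_sub hlt])
  · by_cases hm : m = 0
    · subst hm
      by_cases hk : k = 0
      · subst hk
        exact .inr ⟨by rw [h.A_zero, h.B_zero]; rfl, by rw [h.A_zero, h.B_zero]; rfl⟩
      · exact .inl (by linarith [h.A_le_B 0, h.A_lt_B hk])
    · exact .inl (by linarith [h.A_le_B k, h.A_lt_B hm])

theorem eq_zero_of_isDiff_zero (h : StepPair A B) {y : ℤ} (hd : IsDiff A B 0 y) : y = 0 := by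
  obtain ⟨m, k, ⟨h0, rfl⟩ | ⟨h0, rfl⟩⟩ := hd
  · rw [h.strictMono_A.injective (show A m = A k by linarith)]
    ring
  · obtain ⟨rfl, rfl⟩ := h.ne m k (by linarith)
    rw [h.A_zero, h.B_zero]
    rfl

/-- Removing tokens from one heap only does not lead from a position to a position. -/
theorem not_isDiff_zero (h : StepPair A B) {y : ℤ} (hy : 0 < y) :
    ¬ (IsDiff A B 0 y ∨ IsDiff A B y 0) := by
  rintro (hd | hd)
  · exact hy.ne' (h.eq_zero_of_isDiff_zero hd)
  · rcases h.isDiff_lt hd hy.le with h1 | h1 <;> omega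

theorem not_isDiff_of_le (h : StepPair A B) {x y : ℤ} (hx : 0 < x) (hxy : x ≤ y)
    (hd : ¬ IsDiff A B x y) : ¬ (IsDiff A B x y ∨ IsDiff A B y x) := by
  rintro (hd' | hd')
  · exact hd hd'
  · rcases h.isDiff_lt hd' (by omega) with h1 | h1 <;> omega

/-- Below the line through the positions, only differences of the first kind occur. -/
theorem eq_sub_of_isDiff (h : StepPair A B) {n : ℕ} {y : ℤ} (hy : y < B n)
    (hd : IsDiff A B (A n) y) : ∃ m k, 1 ≤ k ∧ k < m ∧ A n = A m - A k ∧ y = B m - B k := by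
  obtain ⟨m, k, ⟨h1, rfl⟩ | ⟨h1, rfl⟩⟩ := hd
  · have hk : k ≠ 0 := by
      rintro rfl
      have : n = m := h.strictMono_A.injective (by rw [h1, h.A_zero, sub_zero])
      rw [this, h.B_zero] at hy
      omega
    refine ⟨m, k, by omega, ?_, h1, rfl⟩
    by_contra! hmk
    have h2 := h.strictMono_A.monotone hmk
    have h3 : n = 0 := by
      by_contra hn
      have := h.strictMono_A (Nat.pos_of_ne_zero hn)
      rw [h.A_zero] at this
      omega
    subst h3
    rw [h.A_zero] at h1
    have : m = k := h.strictMono_A.injective (by omega)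
    rw [this, h.B_zero] at hy
    omega
  · exfalso
    -- The mixed kind overshoots: for m = n + s it gives A k ≤ B k ≤ 2s, so y = B m - A k ≥ B n + s,
    -- against y < B n.
    have hlin : ∀ s, A (n + s) ≤ A n + 2 * s ∧ B n + 3 * s ≤ B (n + s) := by
      intro s
      induction s with
      | zero => simp
      | succ s ih =>
        have := h.A_le (n + s)
        have := h.B_le (n + s)
        rw [← add_assoc]
        push_cast
        omega
    have hnm : n ≤ m := h.strictMono_A.le_iff_le.1 (by linarith [h.B_nonneg k])
    obtain ⟨s, rfl⟩ := Nat.exists_eq_add_of_le hnm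
    have h2 := hlin s
    have h4 := h.A_le_B k
    omega

theorem A_two (h : StepPair A B) : A 2 = 2 := by
  have h1 := h.A_lt 1
  have h2 := h.A_le 1
  have h3 : A 2 ≠ 3 := fun h3 => by simpa using h.ne 2 1 (h3.trans h.B_one.symm)
  have := h.A_one
  norm_num at h1 h2
  omega

/-- Moving to `(1, 3)` replies to the positions `(2, z + 3)` with `z + 3` close to `b`. -/
theorem not_isDiff_one (h : StepPair A B) {b : ℤ} (hb : 3 ≤ b) (hb5 : b ≠ 5) (hb6 : b ≠ 6)
    (hstep : ∀ n, 1 ≤ n → B n + b ≤ B (n + 1)) {z : ℤ} (hz : z + 2 ≤ b) (hz3 : b ≤ z + 3) :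
    ¬ (IsDiff A B 1 z ∨ IsDiff A B z 1) := by
  rcases eq_or_ne z 0 with rfl | hz0
  · exact fun hd => h.not_isDiff_zero one_pos hd.symm
  refine h.not_isDiff_of_le one_pos (by omega) ?_
  rintro ⟨m, k, ⟨h1, rfl⟩ | ⟨h1, rfl⟩⟩
  · have hkm : k < m := h.strictMono_A.lt_iff_lt.1 (by omega)
    have hB : B (k + 1) ≤ B m := h.strictMono_B.monotone hkm
    -- For k = 0 the difference is (1, 3), so z = 3 and b is 5 or 6, the excluded values. For k ≥ 1
    -- a full step of B makes z at least b.
    rcases Nat.eq_zero_or_pos k with rfl | hk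
    · have hm : m = 1 := h.strictMono_A.injective (by rw [h.A_one, h1, h.A_zero, sub_zero])
      rw [hm, h.B_zero, h.B_one] at hz hz3
      omega
    · have := hstep k hk
      omega
  · rcases Nat.eq_zero_or_pos k with rfl | hk
    · have hm : m = 1 := h.strictMono_A.injective (by rw [h.A_one, h1, h.B_zero, sub_zero])
      rw [hm, h.A_zero, h.B_one] at hz hz3
      omega
    · have hkm : k < m := h.strictMono_A.lt_iff_lt.1 (by linarith [h.A_le_B k])
      have hB : B (k + 1) ≤ B m := h.strictMono_B.monotone hkm
      have := hstep k hk
      have := h.A_le_B k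
      omega

/-- Moving to `(3, 1)` replies to the positions just below `(A n, B n)`. -/
theorem not_isDiff_sub (h : StepPair A B) {n : ℕ} {y : ℤ} (hn : 4 ≤ A n) (hny : A n ≤ y)
    (hy : y < B n) (hd : ∀ m k, A n - 3 = A m - A k → y - 1 ≠ B m - B k) :
    ¬ (IsDiff A B (A n - 3) (y - 1) ∨ IsDiff A B (y - 1) (A n - 3)) := by
  refine h.not_isDiff_of_le (by omega) (by omega) ?_
  rintro ⟨m, k, ⟨h1, h2⟩ | ⟨h1, h2⟩⟩
  · exact hd m k h1 h2
  rcases Nat.eq_zero_or_pos k with rfl | hk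
  · exact hd m 0 (by rw [h1, h.A_zero, h.B_zero]) (by rw [h2, h.A_zero, h.B_zero])
  -- For m = n + s one has 3 ≤ B k ≤ 2s + 3 and A k ≤ B k - 2 ≤ 2s + 1, so y - 1 = B m - A k ≥ B n -
  -- 1 + s, against y < B n.
  have hlin : ∀ s, A (n + s) ≤ A n + 2 * s ∧ B n + 3 * s ≤ B (n + s) := by
    intro s
    induction s with
    | zero => simp
    | succ s ih =>
      have := h.A_le (n + s)
      have := h.B_le (n + s)
      rw [← add_assoc]
      push_cast
      omega
  have hBk : 3 ≤ B k := h.B_one ▸ h.strictMono_B.monotone hk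
  have hnm : n ≤ m := h.strictMono_A.le_iff_le.1 (by omega)
  obtain ⟨s, rfl⟩ := Nat.exists_eq_add_of_le hnm
  have h3 := hlin s
  have h4 : B 1 - A 1 ≤ B k - A k := h.strictMono_sub.monotone hk
  rw [h.B_one, h.A_one] at h4
  omega

/-- The number b is the smaller step of B after its first term. The hypothesis `hfar` is the only
one not about single steps: it says that subtracting (3, 1) from a difference below the curve never
gives another difference of the same kind. -/
theorem exists_reply (h : StepPair A B) {b : ℤ} (hb : 3 ≤ b) (hb5 : b ≠ 5) (hb6 : b ≠ 6)
    (hstep : ∀ n, 1 ≤ n → B n + b ≤ B (n + 1)) (hstep' : ∀ n, 1 ≤ n → B (n + 1) ≤ B n + b + 1)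
    (hB2 : B 2 ≤ 2 * b)
    (hfar : ∀ n m k m' k', 4 ≤ A n → 1 ≤ k → A n = A m - A k → B m - B k < B n →
      A n - 3 = A m' - A k' → B m - B k - 1 ≠ B m' - B k')
    {x y : ℤ} (hx : 0 ≤ x) (hxy : x ≤ y) (hP : ¬ IsPos A B x y) :
    ∃ i j, IsPos A B i j ∧ 0 ≤ i ∧ 0 ≤ j ∧ i ≤ x ∧ j ≤ y ∧
      ¬ (IsDiff A B (x - i) (y - j) ∨ IsDiff A B (y - j) (x - i)) := by
  have h00 : IsPos A B 0 0 := ⟨0, .inl ⟨h.A_zero.symm, h.B_zero.symm⟩⟩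
  have h13 : IsPos A B 1 3 := ⟨1, .inl ⟨h.A_one.symm, h.B_one.symm⟩⟩
  have h31 : IsPos A B 3 1 := ⟨1, .inr ⟨h.B_one.symm, h.A_one.symm⟩⟩
  rcases hx.eq_or_lt with rfl | hx0
  · have hy : y ≠ 0 := fun hy => hP (hy ▸ h00)
    refine ⟨0, 0, h00, le_rfl, le_rfl, le_rfl, hxy, ?_⟩
    rw [sub_zero, sub_zero]
    exact h.not_isDiff_zero (by omega)
  obtain ⟨n, hn, rfl | rfl⟩ := h.cover x hx0
  · rcases lt_trichotomy y (B n) with hy | rfl | hy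
    · by_cases hd : IsDiff A B (A n) y
      · obtain ⟨m, k, hk, hkm, h1, rfl⟩ := h.eq_sub_of_isDiff hy hd
        by_cases hn3 : 3 ≤ n
        · have hA3 : A 3 ≤ A n := h.strictMono_A.monotone hn3
          have hA23 := h.A_lt 2
          have hA2 := h.A_two
          have hA3' : A 3 ≠ 3 := fun h3 => by simpa using h.ne 3 1 (h3.trans h.B_one.symm)
          norm_num at hA23
          refine ⟨3, 1, h31, by omega, by omega, by omega, by omega, ?_⟩
          exact h.not_isDiff_sub (by omega) hxy hy fun m' k' => hfar n m k m' k' (by omega) hk h1 hy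
        have hsk := hstep k hk
        have hsk' := hstep' k hk
        -- For n = 1 a difference has y ≥ b ≥ 3 = B 1, which is impossible. For n = 2, y < B 2 ≤ 2b
        -- leaves room for a single step of B, so y is b or b + 1 and the reply (1, 3) is available.
        rcases (show n = 1 ∨ n = 2 by omega) with rfl | rfl
        · have := h.strictMono_B.monotone (show k + 1 ≤ m from hkm)
          rw [h.B_one] at hy
          omega
        · rw [h.A_two] at *
          have hm : m = k + 1 := by
            by_contra hne
            have h2 := h.strictMono_B.monotone (show k + 2 ≤ m by omega)
            have h3 := hstep (k + 1) (by omega)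
            rw [show k + 1 + 1 = k + 2 from rfl] at h3
            omega
          subst hm
          refine ⟨1, 3, h13, by omega, by omega, by omega, by omega, ?_⟩
          exact h.not_isDiff_one hb hb5 hb6 hstep (by omega) (by omega)
      · refine ⟨0, 0, h00, le_rfl, le_rfl, hx, by omega, ?_⟩
        rw [sub_zero, sub_zero]
        exact h.not_isDiff_of_le hx0 hxy hd
    · exact (hP ⟨n, .inl ⟨rfl, rfl⟩⟩).elim
    · refine ⟨A n, B n, ⟨n, .inl ⟨rfl, rfl⟩⟩, hx, h.B_nonneg n, le_rfl, hy.le, ?_⟩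
      rw [sub_self]
      exact h.not_isDiff_zero (by omega)
  · have hlt : A n < B n := h.A_lt_B (by omega)
    refine ⟨B n, A n, ⟨n, .inr ⟨rfl, rfl⟩⟩, hx, h.A_nonneg n, le_rfl, by omega, ?_⟩
    rw [sub_self]
    exact h.not_isDiff_zero (by omega)

end StepPair

/-! ### From integer pairs to game positions -/

theorem IsPos.symm {A B : ℕ → ℤ} {x y : ℤ} (h : IsPos A B x y) : IsPos A B y x := by
  obtain ⟨n, h | h⟩ := h
  · exact ⟨n, .inr h.symm⟩
  · exact ⟨n, .inl h.symm⟩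

theorem isDiff_of_mem_differences {α β γ δ : ℝ} {d : ℕ × ℕ}
    (h : d ∈ differences (positions α β γ δ)) :
    IsDiff (seq α γ) (seq β δ) d.1 d.2 ∨ IsDiff (seq α γ) (seq β δ) d.2 d.1 := by
  obtain ⟨q, ⟨k, hk⟩, ⟨m, hm⟩⟩ := h
  simp only [Prod.fst_add, Prod.snd_add, Nat.cast_add] at hm
  rcases hk with ⟨h1, h2⟩ | ⟨h1, h2⟩ <;> rcases hm with ⟨h3, h4⟩ | ⟨h3, h4⟩
  · exact .inl ⟨m, k, .inl ⟨by linarith, by linarith⟩⟩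
  · exact .inr ⟨m, k, .inr ⟨by linarith, by linarith⟩⟩
  · exact .inl ⟨m, k, .inr ⟨by linarith, by linarith⟩⟩
  · exact .inr ⟨m, k, .inl ⟨by linarith, by linarith⟩⟩

theorem hasInvariantGame_of_reply {α β γ δ : ℝ}
    (h : ∀ x y : ℤ, 0 ≤ x → x ≤ y → ¬ IsPos (seq α γ) (seq β δ) x y →
      ∃ i j, IsPos (seq α γ) (seq β δ) i j ∧ 0 ≤ i ∧ 0 ≤ j ∧ i ≤ x ∧ j ≤ y ∧
        ¬ (IsDiff (seq α γ) (seq β δ) (x - i) (y - j) ∨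
          IsDiff (seq α γ) (seq β δ) (y - j) (x - i))) :
    HasInvariantGame α β γ δ := by
  refine exists_pPositions_eq ⟨0, by simp [seq]⟩ ?_
  rintro ⟨x, y⟩ hp
  have key : ∃ i j : ℕ, IsPos (seq α γ) (seq β δ) i j ∧ i ≤ x ∧ j ≤ y ∧
      ¬ (IsDiff (seq α γ) (seq β δ) (x - i) (y - j) ∨
        IsDiff (seq α γ) (seq β δ) (y - j) (x - i)) := by
    rcases le_total x y with hxy | hxy
    · obtain ⟨i, j, hij, hi, hj, hix, hjy, hd⟩ := h x y (by omega) (by omega) hp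
      lift i to ℕ using hi
      lift j to ℕ using hj
      exact ⟨i, j, hij, by omega, by omega, hd⟩
    · obtain ⟨i, j, hij, hi, hj, hix, hjy, hd⟩ := h y x (by omega) (by omega) fun h => hp h.symm
      lift i to ℕ using hi
      lift j to ℕ using hj
      exact ⟨j, i, hij.symm, by omega, by omega, fun h => hd h.symm⟩
  obtain ⟨i, j, hij, hi, hj, hd⟩ := key
  refine ⟨(i, j), hij, (x - i, y - j), fun h => hd ?_, ?_⟩
  · have := isDiff_of_mem_differences h
    simpa only [Nat.cast_sub hi, Nat.cast_sub hj] using this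
  · ext <;> simp <;> omega

/-! ## Non-homogeneous Beatty sequences -/

@[simp] theorem seq_zero (θ ρ : ℝ) : seq θ ρ 0 = 0 := if_pos rfl

theorem seq_eq_iff {θ ρ : ℝ} {n : ℕ} (hn : n ≠ 0) {k : ℤ} :
    seq θ ρ n = k ↔ k ≤ n * θ + ρ ∧ n * θ + ρ < k + 1 := by
  rw [seq, if_neg hn, Int.floor_eq_iff]

theorem seq_le {θ ρ : ℝ} {n : ℕ} (hn : n ≠ 0) : (seq θ ρ n : ℝ) ≤ n * θ + ρ :=
  ((seq_eq_iff hn).1 rfl).1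

theorem lt_seq_add_one {θ ρ : ℝ} {n : ℕ} (hn : n ≠ 0) : n * θ + ρ < seq θ ρ n + 1 :=
  ((seq_eq_iff hn).1 rfl).2

/-- The steps of a Beatty sequence after the first term. -/
theorem le_seq_succ {θ ρ : ℝ} {b : ℤ} (hb : (b : ℝ) ≤ θ) {n : ℕ} (hn : n ≠ 0) :
    seq θ ρ n + b ≤ seq θ ρ (n + 1) := by
  have h1 := seq_le (θ := θ) (ρ := ρ) hn
  have h2 := lt_seq_add_one (θ := θ) (ρ := ρ) n.succ_ne_zero
  push_cast at h2
  have : (seq θ ρ n + b : ℤ) < seq θ ρ (n + 1) + 1 := by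
    have : ((seq θ ρ n + b : ℤ) : ℝ) < (seq θ ρ (n + 1) + 1 : ℤ) := by
      push_cast
      linarith
    exact_mod_cast this
  omega

theorem seq_succ_le {θ ρ : ℝ} {b : ℤ} (hb : θ ≤ b + 1) {n : ℕ} (hn : n ≠ 0) :
    seq θ ρ (n + 1) ≤ seq θ ρ n + b + 1 := by
  have h1 := lt_seq_add_one (θ := θ) (ρ := ρ) hn
  have h2 := seq_le (θ := θ) (ρ := ρ) n.succ_ne_zero
  push_cast at h2
  have : seq θ ρ (n + 1) < (seq θ ρ n + b + 2 : ℤ) := by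
    have : (seq θ ρ (n + 1) : ℝ) < (seq θ ρ n + b + 2 : ℤ) := by
      push_cast
      linarith
    exact_mod_cast this
  omega

/-- A positive integer outside a Beatty sequence lies in a gap of it. -/
theorem exists_gap {θ ρ : ℝ} (hθ : 0 < θ) (hρ : ρ < 1) {k : ℤ} (hk : 0 < k)
    (h : ∀ n : ℕ, 1 ≤ n → seq θ ρ n ≠ k) :
    ∃ n : ℕ, n * θ + ρ < k ∧ (k : ℝ) + 1 ≤ (n + 1 : ℕ) * θ + ρ := by
  have hk1 : (1 : ℝ) ≤ k := by exact_mod_cast hk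
  have hex : ∃ n : ℕ, (k : ℝ) ≤ n * θ + ρ := by
    obtain ⟨n, hn⟩ := exists_nat_ge ((k - ρ) / θ)
    exact ⟨n, by rw [div_le_iff₀ hθ] at hn; linarith⟩
  classical
  have hs := Nat.find_spec hex
  have hm := fun m => Nat.find_min (m := m) hex
  generalize Nat.find hex = n at hs hm
  rcases n with _ | n
  -- Index 0 cannot be the least one, since ρ < 1 ≤ k. The gap uses the affine value ρ at index 0,
  -- not the conventional value of `seq` there.
  · simp at hs
    linarith
  refine ⟨n, not_le.1 (hm n n.lt_succ_self), ?_⟩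
  by_contra! hlt
  exact h (n + 1) (by omega) ((seq_eq_iff n.succ_ne_zero).2 ⟨hs, hlt⟩)

/-- By `hbal` and 1/α + 1/β = 1, dividing by α and β and adding turns terms with indices n and m
into n + m, and an integer k into k. A common value k would put n + m strictly between k and k + 1;
a missed value k would give n + m < k and k + 1 < n + m + 2. -/
theorem standing_of {α β γ δ : ℝ} (hβ3 : 3 < β) (hα : α = β / (β - 1)) (hβ : Irrational β)
    (hbal : γ / α + δ / β = 0) (hγ : γ < 1) (hδ : δ < 1) (hA : seq α γ 1 = 1) (hB : seq β δ 1 = 3)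
    (hint : ∀ n : ℕ, 1 ≤ n → ∀ k : ℤ, (n : ℝ) * β + δ ≠ k) : Standing α β γ δ := by
  have hα0 : 0 < α := hα ▸ div_pos (by linarith) (by linarith)
  have hmul : α * (β - 1) = β := by rw [hα, div_mul_cancel₀ _ (by linarith)]
  have hα1 : 1 < α := by nlinarith
  have hα2 : α < 3 / 2 := by nlinarith
  have hinv : 1 / α + 1 / β = 1 := by
    have : β ≠ 0 := by linarith
    field_simp
    linarith
  have hsum : ∀ n m : ℕ, ((n : ℝ) * α + γ) / α + (m * β + δ) / β = n + m := by
    intro n m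
    rw [add_div, add_div, mul_div_cancel_right₀ _ hα0.ne',
      mul_div_cancel_right₀ _ (by linarith : β ≠ 0)]
    linarith
  have hk : ∀ x : ℝ, x / α + x / β = x := fun x => by
    have : x / α + x / β = x * (1 / α + 1 / β) := by ring
    rw [this, hinv, mul_one]
  have hβ0 : 0 < β := by linarith
  refine
    { pos := hα0
      lt := by linarith
      irrational_left := ?_
      irrational_right := hβ
      inv_add_inv := hinv
      disjoint := ?_
      union := ?_
      first_left := hA
      first_right := hB.ge
      balance := hbal
      not_int := hint }
  · have : α = 1 + (β - 1)⁻¹ := by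
      have : β - 1 ≠ 0 := by linarith
      rw [hα]
      field_simp
      ring
    rw [this]
    have h1 : Irrational (β - 1) := by simpa using hβ.sub_intCast 1
    simpa using h1.inv.intCast_add 1
  · rw [Set.disjoint_left]
    rintro k ⟨n, hn, rfl⟩ ⟨m, hm, hmn⟩
    have h1 := seq_le (θ := α) (ρ := γ) (n := n) (by omega)
    have h2 := lt_seq_add_one (θ := α) (ρ := γ) (n := n) (by omega)
    obtain ⟨h3, h4⟩ := (seq_eq_iff (by omega)).1 hmn
    -- Strictness on the β side, from `hint`, is enough to make the summed inequality strict.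
    replace h3 := lt_of_le_of_ne h3 (hint m hm _).symm
    generalize seq α γ n = k at *
    have e1 := div_le_div_of_nonneg_right h1 hα0.le
    have e2 := div_lt_div_of_pos_right h2 hα0
    have e3 := div_lt_div_of_pos_right h3 hβ0
    have e4 := div_lt_div_of_pos_right h4 hβ0
    have f1 : (k : ℝ) < n + m := by linarith [hsum n m, hk k]
    have f2 : (n : ℝ) + m < k + 1 := by linarith [hsum n m, hk (k + 1)]
    have g1 : k < n + m := by exact_mod_cast f1
    have g2 : (n : ℤ) + m < k + 1 := by exact_mod_cast f2
    omega
  · ext k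
    simp only [Set.mem_union, Set.mem_ofPred_eq]
    constructor
    · have hpos : ∀ θ ρ : ℝ, 1 < θ → 0 < seq θ ρ 1 → ∀ n : ℕ, 1 ≤ n → 0 < seq θ ρ n := by
        intro θ ρ hθ h1 n hn
        induction n, hn using Nat.le_induction with
        | base => exact h1
        | succ n hn ih =>
          have := le_seq_succ (θ := θ) (ρ := ρ) (b := 1) (by simpa using hθ.le)
            (Nat.one_le_iff_ne_zero.1 hn)
          omega
      rintro (⟨n, hn, rfl⟩ | ⟨n, hn, rfl⟩)
      · exact hpos α γ hα1 (by omega) n hn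
      · exact hpos β δ (by linarith) (by omega) n hn
    · intro hk0
      by_contra! hno
      obtain ⟨n, h1, h2⟩ := exists_gap hα0 hγ hk0 hno.1
      obtain ⟨m, h3, h4⟩ := exists_gap hβ0 hδ hk0 hno.2
      replace h4 := lt_of_le_of_ne h4 fun h =>
        hint (m + 1) (by omega) (k + 1) (by rw [← h]; push_cast; rfl)
      have e1 := div_lt_div_of_pos_right h1 hα0
      have e2 := div_le_div_of_nonneg_right h2 hα0.le
      have e3 := div_lt_div_of_pos_right h3 hβ0
      have e4 := div_lt_div_of_pos_right h4 hβ0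
      have f1 : (n : ℝ) + m < k := by linarith [hsum n m, hk k]
      have f2 : (k : ℝ) + 1 < (n + 1 : ℕ) + (m + 1 : ℕ) := by
        linarith [hsum (n + 1) (m + 1), hk (k + 1)]
      have g1 : (n : ℤ) + m < k := by exact_mod_cast f1
      have g2 : k + 1 < ((n + 1 : ℕ) : ℤ) + (m + 1 : ℕ) := by exact_mod_cast f2
      push_cast at g2
      omega

theorem Standing.stepPair {α β γ δ : ℝ} (h : Standing α β γ δ) (hβ3 : 3 < β)
    (hB : seq β δ 1 = 3) : StepPair (seq α γ) (seq β δ) := by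
  have hinv := h.inv_add_inv
  have hα0 := h.pos
  have hmul : α * (β - 1) = β := by
    have : β ≠ 0 := by linarith
    field_simp at hinv
    linarith
  have hα1 : 1 < α := by nlinarith
  have hα2 : α < 3 / 2 := by nlinarith
  have hAB : ∀ m n : ℕ, 1 ≤ m → 1 ≤ n → seq α γ m ≠ seq β δ n := fun m n hm hn e =>
    Set.disjoint_left.1 h.disjoint ⟨m, hm, rfl⟩ ⟨n, hn, e.symm⟩
  have hpos : ∀ k : ℤ, ((∃ n : ℕ, 1 ≤ n ∧ seq α γ n = k) ∨ ∃ n : ℕ, 1 ≤ n ∧ seq β δ n = k) ↔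
      0 < k := fun k => Set.ext_iff.1 h.union k
  refine
    { A_zero := seq_zero _ _
      B_zero := seq_zero _ _
      A_one := h.first_left
      B_one := hB
      A_lt := fun n => ?_
      A_le := fun n => ?_
      B_le := fun n => ?_
      cover := fun k hk => ?_
      ne := fun m n hmn => ?_ }
  · rcases eq_or_ne n 0 with rfl | hn
    · rw [zero_add, h.first_left, seq_zero]
      norm_num
    · have := le_seq_succ (θ := α) (ρ := γ) (b := 1) (by simpa using hα1.le) hn
      omega
  · rcases eq_or_ne n 0 with rfl | hn
    · rw [zero_add, h.first_left, seq_zero]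
      norm_num
    · have := seq_succ_le (θ := α) (ρ := γ) (b := 1) (by push_cast; linarith) hn
      omega
  · rcases eq_or_ne n 0 with rfl | hn
    · rw [zero_add, hB, seq_zero]
      norm_num
    · exact le_seq_succ (b := 3) (by push_cast; linarith) hn
  · rcases (hpos k).2 hk with ⟨n, hn, hk⟩ | ⟨n, hn, hk⟩
    · exact ⟨n, hn, .inl hk⟩
    · exact ⟨n, hn, .inr hk⟩
  · rcases Nat.eq_zero_or_pos m with rfl | hm <;> rcases Nat.eq_zero_or_pos n with rfl | hn
    · exact ⟨rfl, rfl⟩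
    · have := (hpos _).1 (.inr ⟨n, hn, rfl⟩)
      rw [← hmn, seq_zero] at this
      omega
    · have := (hpos _).1 (.inl ⟨m, hm, rfl⟩)
      rw [hmn, seq_zero] at this
      omega
    · exact (hAB m n hm hn hmn).elim

/-- Reason for `hfar`: the first equation forces m - k ≥ n - 1, and the one with A n - 3 forces m' -
k' ≤ n - 2. The B-differences then exceed (n - 1)β - 1 and stay below (n - 2)β + 1 respectively, so
they cannot differ by exactly 1 when β > 3. -/
theorem Standing.hasInvariantGame {α β γ δ : ℝ} (h : Standing α β γ δ) (hβ3 : 3 < β)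
    (hγ : 2 ≤ 2 * α + γ) (hδ : δ < 1) (hB : seq β δ 1 = 3) {b : ℤ} (hb : 3 ≤ b) (hb5 : b ≠ 5)
    (hb6 : b ≠ 6) (hbβ : b ≤ β) (hβb : β ≤ b + 1) (hB2 : seq β δ 2 ≤ 2 * b) :
    HasInvariantGame α β γ δ := by
  have hS := h.stepPair hβ3 hB
  refine hasInvariantGame_of_reply fun x y => hS.exists_reply hb hb5 hb6
    (fun n hn => le_seq_succ hbβ (by omega)) (fun n hn => seq_succ_le hβb (by omega)) hB2 ?_
  have hinv := h.inv_add_inv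
  have hα0 := h.pos
  have hmul : α * (β - 1) = β := by
    have : β ≠ 0 := by linarith
    field_simp at hinv
    linarith
  have hα1 : 1 < α := by nlinarith
  have hαγ : α + γ < 2 := by
    have := ((seq_eq_iff one_ne_zero).1 h.first_left).2
    norm_num at this
    linarith
  intro n m k m' k' hA4 hk hA hBlt hA' hB'
  have hn : n ≠ 0 := by
    rintro rfl
    rw [seq_zero] at hA4
    omega
  have hkm : k < m := hS.strictMono_A.lt_iff_lt.1 (by omega)
  have hkm' : k' < m' := hS.strictMono_A.lt_iff_lt.1 (by omega)
  have hAr : (seq α γ n : ℝ) = seq α γ m - seq α γ k := by exact_mod_cast hA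
  have hAr' : (seq α γ n : ℝ) - 3 = seq α γ m' - seq α γ k' := by exact_mod_cast hA'
  have hBr' : (seq β δ m : ℝ) - seq β δ k - 1 = seq β δ m' - seq β δ k' := by exact_mod_cast hB'
  have a1 := seq_le (θ := α) (ρ := γ) hn
  have a2 := lt_seq_add_one (θ := α) (ρ := γ) hn
  have a3 := seq_le (θ := α) (ρ := γ) (n := m) (by omega)
  have a4 := lt_seq_add_one (θ := α) (ρ := γ) (n := k) (by omega)
  have b1 := lt_seq_add_one (θ := β) (ρ := δ) (n := m) (by omega)
  have b2 := seq_le (θ := β) (ρ := δ) (n := k) (by omega)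
  -- An index difference of at most n - 2 would give 2α + γ < 2.
  have hr : (n : ℤ) - 1 ≤ m - k := by
    by_contra! hlt
    have : (m : ℝ) - k ≤ n - 2 := by exact_mod_cast (by omega : (m : ℤ) - k ≤ n - 2)
    have := mul_le_mul_of_nonneg_right this hα0.le
    linarith
  have hr' : (n : ℝ) - 1 ≤ m - k := by exact_mod_cast hr
  have hlow := mul_le_mul_of_nonneg_right hr' (by linarith : 0 ≤ β)
  have hupper : ((m' : ℝ) - k' - n) * α < -α ∧
      (seq β δ m' : ℝ) - seq β δ k' < ((m' : ℝ) - k') * β + 1 := by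
    have c1 := lt_seq_add_one (θ := α) (ρ := γ) (n := m') (by omega)
    have d1 := seq_le (θ := β) (ρ := δ) (n := m') (by omega)
    -- The term at index 0 is 0 rather than a floor, so k' = 0 is separate: there α < 2 and δ < 1
    -- replace the usual bounds.
    rcases Nat.eq_zero_or_pos k' with rfl | hk'
    · rw [seq_zero, Int.cast_zero] at *
      rw [Nat.cast_zero]
      have hα2 : α < 2 := by nlinarith
      constructor <;> linarith
    · have c2 := seq_le (θ := α) (ρ := γ) (n := k') (by omega)
      have d2 := lt_seq_add_one (θ := β) (ρ := δ) (n := k') (by omega)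
      constructor <;> linarith
  have hr2 : (m' : ℝ) - k' - n < -1 :=
    lt_of_mul_lt_mul_right (by linarith [hupper.1]) hα0.le
  have hr3 : (m' : ℤ) - k' - n < -1 := by exact_mod_cast hr2
  have hr4 : (m' : ℝ) - k' ≤ n - 2 := by exact_mod_cast (by omega : (m' : ℤ) - k' ≤ n - 2)
  have hup := mul_le_mul_of_nonneg_right hr4 (by linarith : 0 ≤ β)
  linarith [hupper.2]

/-! ## The two counterexamples -/

theorem sqrt_five_bounds : 2.236 < √5 ∧ √5 < 2.2361 :=
  ⟨Real.lt_sqrt_of_sq_lt (by norm_num), (Real.sqrt_lt' (by norm_num)).2 (by norm_num)⟩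

theorem sqrt_seven_bounds : 2.6457 < √7 ∧ √7 < 2.6458 :=
  ⟨Real.lt_sqrt_of_sq_lt (by norm_num), (Real.sqrt_lt' (by norm_num)).2 (by norm_num)⟩

theorem irrational_sqrt_five : Irrational √5 := by
  simpa using (by norm_num : Nat.Prime 5).irrational_sqrt

theorem irrational_sqrt_seven : Irrational √7 := by
  simpa using (by norm_num : Nat.Prime 7).irrational_sqrt

/-- The prefixes to test are a and aa. They contain no b, while either form of suffix-badness,
applied to the whole prefix, asks for a factor with a negative number of b's. -/
theorem good_of_replicate {α β γ δ : ℝ} (hγ : γ < 0) (hB : seq β δ 1 = 3)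
    (h0 : word α β γ δ 0 = letterA β) (h1 : word α β γ δ 1 = letterA β) : Good α β γ δ := by
  refine .inr ⟨hγ, fun n hn hn3 _ hbad => ?_⟩
  have hba : letterA β ≠ letterB β := by simp [letterA, letterB]
  have hcount : (factor (word α β γ δ) 0 n).count (letterB β) = 0 := by
    rcases (by omega : n = 1 ∨ n = 2) with rfl | rfl <;>
      simp [factor, List.range_succ, h0, h1, hba]
  have hlen : (factor (word α β γ δ) 0 n).length = n := by simp [factor]
  rcases hbad with h | ⟨h2, h⟩
  · obtain ⟨v, -, -, hv⟩ := h 0 (by omega)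
    rw [List.drop_zero] at hv
    omega
  · obtain ⟨v, -, hv⟩ := h 0 (by omega)
    rw [List.drop_zero] at hv
    have hdrop : (factor (word α β γ δ) 0 n).dropLast.count (letterB β) = 0 :=
      Nat.le_zero.1 (((List.dropLast_sublist _).count_le _).trans hcount.le)
    simp only [parikh, Prod.mk_add_mk, Prod.mk.injEq, hdrop] at hv
    omega

theorem counterexample_neg {α β γ δ : ℝ} (hβ : β = 1.99 + √5 / 2) (hα : α = β / (β - 1))
    (hγ : γ = -0.2) (hδ : δ = -(β * γ / α)) :
    Standing α β γ δ ∧ Good α β γ δ ∧ HasInvariantGame α β γ δ ∧ ¬ Superadditive (seq β δ) ∧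
      ¬ FirstSuperadditive (seq β δ) := by
  obtain ⟨hs1, hs2⟩ := sqrt_five_bounds
  have hβ1 : 3.108 < β := by rw [hβ]; linarith
  have hβ2 : β < 3.1081 := by rw [hβ]; linarith
  have hmul : α * (β - 1) = β := by rw [hα, div_mul_cancel₀ _ (by linarith)]
  have hα0 : 0 < α := hα ▸ div_pos (by linarith) (by linarith)
  have hα1 : 1.47 < α := by nlinarith
  have hα2 : α < 1.48 := by nlinarith
  -- Here β / α = β - 1.
  have hδ' : δ = 0.2 * (β - 1) := by
    rw [hδ, hγ]
    nth_rewrite 1 [← hmul]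
    field_simp
  have hbal : γ / α + δ / β = 0 := by
    have : β ≠ 0 := by linarith
    rw [hδ]
    field_simp
    ring
  have hA1 : seq α γ 1 = 1 := (seq_eq_iff one_ne_zero).2 (by constructor <;> norm_num <;> linarith)
  have hB1 : seq β δ 1 = 3 := (seq_eq_iff one_ne_zero).2 (by constructor <;> norm_num <;> linarith)
  have hB2 : seq β δ 2 = 6 := (seq_eq_iff two_ne_zero).2 (by constructor <;> norm_num <;> linarith)
  have hB6 : seq β δ 6 = 19 :=
    (seq_eq_iff (by norm_num)).2 (by constructor <;> norm_num <;> linarith)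
  have hB12 : seq β δ 12 = 37 :=
    (seq_eq_iff (by norm_num)).2 (by constructor <;> norm_num <;> linarith)
  have hirr : ∀ (p q : ℚ), p ≠ 0 → Irrational ((p : ℝ) * √5 + q) := fun p q hp =>
    (irrational_sqrt_five.ratCast_mul hp).add_ratCast q
  have hint : ∀ n : ℕ, 1 ≤ n → ∀ k : ℤ, (n : ℝ) * β + δ ≠ k := by
    intro n hn k h
    refine (hirr ((n + 1 / 5) / 2) (199 / 100 * n + 198 / 1000) (by positivity)).ne_int k ?_
    rw [← h, hδ', hβ]
    push_cast
    ring
  have hst : Standing α β γ δ := by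
    refine standing_of (by linarith) hα ?_ hbal (by linarith) (by linarith) hA1 hB1 hint
    convert hirr (1 / 2) (199 / 100) (by norm_num) using 1
    rw [hβ]
    push_cast
    ring
  have hfloor : ⌊β⌋ = 3 := Int.floor_eq_iff.2 (by constructor <;> norm_num <;> linarith)
  have hA2 := (hst.stepPair (by linarith) hB1).A_two
  -- Superadditivity fails at 6 + 6, since 19 + 19 > 37.
  have hsup : ¬ Superadditive (seq β δ) := fun h => by
    have := h 6 6 (by norm_num) (by norm_num)
    norm_num [hB6, hB12] at this
  refine ⟨hst, ?_, ?_, hsup, fun h => hsup fun m n hm hn => (h m n hm hn).1⟩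
  · refine good_of_replicate (by linarith) hB1 ?_ ?_
    · simp [word, letterA, hfloor, hA1, hB1]
    · simp [word, letterA, hfloor, hA1, hB1, hA2, hB2]
  · exact hst.hasInvariantGame (b := 3) (by linarith) (by linarith) (by linarith) hB1 (by norm_num)
      (by norm_num) (by norm_num) (by norm_num; linarith) (by norm_num; linarith) (by omega)

/-- The number `n √5 - 5 √7` is irrational. -/
theorem mul_sqrt_five_sub_ne (n : ℕ) (q : ℚ) : (n : ℝ) * √5 - 5 * √7 ≠ q := by
  intro h
  have h5 : √5 ^ 2 = 5 := Real.sq_sqrt (by norm_num)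
  have h7 : √7 ^ 2 = 7 := Real.sq_sqrt (by norm_num)
  have h1 : (n : ℝ) * √5 = q + 5 * √7 := by linarith
  have h2 : (n : ℝ) ^ 2 * 5 = q ^ 2 + 175 + 10 * q * √7 := by
    have : ((n : ℝ) * √5) ^ 2 = (q + 5 * √7) ^ 2 := by rw [h1]
    rw [mul_pow, h5] at this
    rw [this]
    linear_combination 25 * h7
  -- If q = 0 then n² = 35, not a square; otherwise the squared equation makes √7 rational.
  rcases eq_or_ne q 0 with rfl | hq
  · have h3 : n ^ 2 * 5 = 175 := by
      have : (n : ℝ) ^ 2 * 5 = 175 := by rw [h2]; norm_num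
      exact_mod_cast this
    have h4 : n < 6 := by nlinarith
    interval_cases n <;> omega
  · have hirr := (irrational_sqrt_seven.ratCast_mul (q := 10 * q) (by simpa using hq)).add_ratCast
      (q ^ 2 + 175)
    refine hirr.ne_rat (n ^ 2 * 5) ?_
    push_cast
    linarith

theorem counterexample_pos {α β γ δ : ℝ} (hβ : β = 8 + (1 + √5) / 2) (hα : α = β / (β - 1))
    (hδ : δ = -(5 * √7 / 2)) (hγ : γ = -(δ * α / β)) :
    Standing α β γ δ ∧ 0 < γ ∧ Good α β γ δ ∧ HasInvariantGame α β γ δ ∧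
      Superadditive (seq β δ) ∧ seq β δ 1 = 3 ∧ seq β δ 2 = 12 ∧ seq β δ 3 = 22 ∧
      2 * seq β δ 1 + seq β δ 2 < seq β δ 3 ∧ ¬ FirstSuperadditive (seq β δ) := by
  obtain ⟨hs1, hs2⟩ := sqrt_five_bounds
  obtain ⟨ht1, ht2⟩ := sqrt_seven_bounds
  have hβ1 : 9.618 < β := by rw [hβ]; linarith
  have hβ2 : β < 9.6181 := by rw [hβ]; linarith
  have hδ1 : -6.6145 < δ := by rw [hδ]; linarith
  have hδ2 : δ < -6.61425 := by rw [hδ]; linarith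
  have hmul : α * (β - 1) = β := by rw [hα, div_mul_cancel₀ _ (by linarith)]
  have hα0 : 0 < α := hα ▸ div_pos (by linarith) (by linarith)
  have hα1 : 1.116 < α := by nlinarith
  have hα2 : α < 1.117 := by nlinarith
  have hγ' : γ * (β - 1) = -δ := by
    have : β ≠ 0 := by linarith
    have hγβ : γ * β = -δ * α := by
      rw [hγ]
      field_simp
    apply mul_left_cancel₀ hα0.ne'
    linear_combination γ * hmul + hγβ
  have hγ1 : 0 < γ := by nlinarith
  have hγ2 : γ < 0.8 := by nlinarith
  have hbal : γ / α + δ / β = 0 := by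
    have : β ≠ 0 := by linarith
    rw [hγ]
    field_simp
    ring
  have hA1 : seq α γ 1 = 1 := (seq_eq_iff one_ne_zero).2 (by constructor <;> norm_num <;> linarith)
  have hB1 : seq β δ 1 = 3 := (seq_eq_iff one_ne_zero).2 (by constructor <;> norm_num <;> linarith)
  have hB2 : seq β δ 2 = 12 := (seq_eq_iff two_ne_zero).2 (by constructor <;> norm_num <;> linarith)
  have hB3 : seq β δ 3 = 22 :=
    (seq_eq_iff three_ne_zero).2 (by constructor <;> norm_num <;> linarith)
  have hint : ∀ n : ℕ, 1 ≤ n → ∀ k : ℤ, (n : ℝ) * β + δ ≠ k := by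
    intro n _ k h
    -- Doubling nβ + δ = k and removing the rational part 17n leaves n√5 - 5√7.
    refine mul_sqrt_five_sub_ne n (2 * k - 17 * n) ?_
    push_cast
    rw [← h, hβ, hδ]
    ring
  have hst : Standing α β γ δ := by
    refine standing_of (by linarith) hα ?_ hbal (by linarith) (by linarith) hA1 hB1 hint
    convert (irrational_sqrt_five.ratCast_mul (q := 1 / 2) (by norm_num)).add_ratCast (17 / 2) using 1
    rw [hβ]
    push_cast
    ring
  have hsup : Superadditive (seq β δ) := by
    intro m n hm hn
    have h1 := seq_le (θ := β) (ρ := δ) hm.ne'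
    have h2 := seq_le (θ := β) (ρ := δ) hn.ne'
    have h3 := lt_seq_add_one (θ := β) (ρ := δ) (n := m + n) (by omega)
    push_cast at h3
    -- Since δ < -1, the second copy of δ on the left absorbs the rounding loss on the right.
    have h4 : ((seq β δ m + seq β δ n : ℤ) : ℝ) ≤ (seq β δ (m + n) : ℤ) := by
      push_cast
      linarith
    exact_mod_cast h4
  refine ⟨hst, hγ1, ?_, ?_, hsup, hB1, hB2, hB3, by omega, fun h => ?_⟩
  · refine .inl ⟨hγ1, fun k hk hk3 _ hbad => ?_⟩
    obtain rfl : k = 1 := by omega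
    -- Each form of badness needs 2B₁ to be 8, 9 or 10, but it is 6.
    have hw : (word α β γ δ 1).2 = 9 := by simp [word, hB1, hB2]
    rw [IsBad, hw, hB1] at hbad
    omega
  · exact hst.hasInvariantGame (b := 9) (by linarith) (by linarith) (by linarith) hB1 (by norm_num)
      (by norm_num) (by norm_num) (by norm_num; linarith) (by norm_num; linarith) (by omega)
  · have := (h 1 2 one_pos two_pos).2
    norm_num [hB1, hB2, hB3] at this

end BeattyGame

theorem mainTheorem4 :
    -- the first counterexample, with `γ < 0`
    (∀ α β γ δ : ℝ, β = 1.99 + Real.sqrt 5 / 2 → α = β / (β - 1) → γ = -0.2 → δ = -(β * γ / α) →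
      BeattyGame.Standing α β γ δ ∧
      BeattyGame.Good α β γ δ ∧
      BeattyGame.HasInvariantGame α β γ δ ∧
      ¬ BeattyGame.Superadditive (BeattyGame.seq β δ) ∧
      ¬ BeattyGame.FirstSuperadditive (BeattyGame.seq β δ)) ∧
    -- the second counterexample, with `γ > 0`
    (∀ α β γ δ : ℝ, β = 8 + (1 + Real.sqrt 5) / 2 → α = β / (β - 1) →
      δ = -(5 * Real.sqrt 7 / 2) → γ = -(δ * α / β) →
      BeattyGame.Standing α β γ δ ∧
      0 < γ ∧
      BeattyGame.Good α β γ δ ∧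
      BeattyGame.HasInvariantGame α β γ δ ∧
      BeattyGame.Superadditive (BeattyGame.seq β δ) ∧
      BeattyGame.seq β δ 1 = 3 ∧ BeattyGame.seq β δ 2 = 12 ∧ BeattyGame.seq β δ 3 = 22 ∧
      2 * BeattyGame.seq β δ 1 + BeattyGame.seq β δ 2 < BeattyGame.seq β δ 3 ∧
      ¬ BeattyGame.FirstSuperadditive (BeattyGame.seq β δ)) ∧
    -- the condition is not necessary
    (¬ ∀ α β γ δ : ℝ, BeattyGame.Complementary α β γ δ → (γ ≠ 0 ∨ δ ≠ 0) →
      BeattyGame.seq α γ 1 = 1 → BeattyGame.HasInvariantGame α β γ δ →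
      BeattyGame.FirstSuperadditive (BeattyGame.seq β δ)) ∧
    -- the conjecture is false
    ¬ BeattyGame.LarssonHegartyFraenkelConjecture := by
  have key : ¬ ∀ α β γ δ : ℝ, BeattyGame.Complementary α β γ δ → (γ ≠ 0 ∨ δ ≠ 0) →
      BeattyGame.seq α γ 1 = 1 → BeattyGame.HasInvariantGame α β γ δ →
      BeattyGame.FirstSuperadditive (BeattyGame.seq β δ) := by
    intro h
    obtain ⟨hst, -, hgame, -, hnot⟩ := BeattyGame.counterexample_neg rfl rfl rfl rfl
    exact hnot (h _ _ _ _ hst.toComplementary (.inl (by norm_num)) hst.first_left hgame)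
  exact ⟨fun α β γ δ hβ hα hγ hδ => BeattyGame.counterexample_neg hβ hα hγ hδ,
    fun α β γ δ hβ hα hδ hγ => BeattyGame.counterexample_pos hβ hα hδ hγ, key,
    fun h => key fun α β γ δ hc h0 h1 hg => (h α β γ δ hc h0 h1).1 hg⟩
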